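/- Let $\tilde p:\mathbb R\to\mathbb R$ be a smooth, positive, $2\pi$-periodic function with $\phi:=\tilde p''+\tilde p>0$. Put $\mathbf T(\theta)=(\cos\theta,\sin\theta)$ and $\mathbf N(\theta)=(-\sin\theta,\cos\theta)$, and let $\tilde A$ be the area enclosed by the closed curve $\theta\mapsto-\tilde p(\theta)\mathbf N(\theta)+\tilde p'(\theta)\mathbf T(\theta)$, which bounds the Wulff shape of $\tilde p$. Along a regular closed plane curve $X(u)$, $u\in\mathbb R/2\pi\mathbb Z$, write $ds=|X_u|\,du$, $T=X_u/|X_u|$, $N$ for $T$ rotated by $+\pi/2$, $\theta$ for the angle from the $x$-axis to $T$, $\kappa$ for the signed curvature, and let $$\mathcal K=\phi(\theta)\kappa,\qquad \mathcal L=\int\tilde p(\theta)\,ds,\qquad \lambda=\int\tilde p(\theta)\,\mathcal K^2\,ds,\qquad A=\frac12\int x\,dy-y\,dx$$ be its anisotropic curvature, its anisotropic length, the nonlocal term, and its enclosed area. Let $X_0$ be a smooth, closed, embedded, counterclockwise oriented convex plane curve with positive curvature, let $0<T_{\max}\le\infty$, and let $X(u,t)$, $u\in\mathbb R/2\pi\mathbb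 Z$, $t\in[0,T_{\max})$, be a smooth family of regular closed plane curves with $X(\cdot,0)=X_0$ and $$\frac{\partial X}{\partial t}=\xi\,T+\tilde p(\theta)\Bigl(\mathcal K-\frac{\lambda(t)}{2\tilde A}\Bigr)N,$$ where the tangential component $\xi=\xi(u,t)$ is arbitrary (for example $\xi=0$, or $\xi=-\partial_\theta\bigl(\tilde p(\mathcal K-\frac{\lambda(t)}{2\tilde A})\bigr)$ if the curves are parametrized by their tangent angle $u=\theta$). Then the anisotropic length $\mathcal L(t)$ of $X(\cdot,t)$ is constant on $[0,T_{\max})$, and the enclosed area $A(t)$ of $X(\cdot,t)$ is non-decreasing on $[0,T_{\max})$. -/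

import Mathlib

open Set Real
open scoped ContDiff

/-! The plane is identified with `ℂ`. A closed curve is a `2π`-periodic map `γ : ℝ → ℂ`, that is, a map
on the circle `ℝ / 2πℤ`. -/

namespace AnisotropicFlow

noncomputable section

/-- The speed `g = |γ_u|`, so that `ds = g du`. -/
def speed (γ : ℝ → ℂ) (u : ℝ) : ℝ := ‖deriv γ u‖

/-- The unit tangent vector `T = γ_u / g`. -/
def unitTangent (γ : ℝ → ℂ) (u : ℝ) : ℂ := deriv γ u / (speed γ u : ℂ)

/-- The unit normal vector `N`: the tangent rotated by `+π/2`, which points inward along a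
counterclockwise closed convex curve. -/
def unitNormal (γ : ℝ → ℂ) (u : ℝ) : ℂ := Complex.I * unitTangent γ u

/-- The tangent angle `θ = ∠(T, x)`. The representative in `(-π, π]` is chosen; below it is only
inserted into `2π`-periodic functions. -/
def tangentAngle (γ : ℝ → ℂ) (u : ℝ) : ℝ := Complex.arg (deriv γ u)

/-- The signed curvature `κ = (x' y'' - y' x'') / g ^ 3`. -/
def curvature (γ : ℝ → ℂ) (u : ℝ) : ℝ :=
  ((deriv γ u).re * (deriv (deriv γ) u).im - (deriv γ u).im * (deriv (deriv γ) u).re) /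
    speed γ u ^ 3

/-- The integral `∫ f ds` over one period of `γ`. -/
def arcIntegral (γ : ℝ → ℂ) (f : ℝ → ℝ) : ℝ := ∫ u in (0 : ℝ)..(2 * π), f u * speed γ u

/-- The enclosed area `(1/2) ∫ x dy - y dx`. -/
def enclosedArea (γ : ℝ → ℂ) : ℝ :=
  (1 / 2) * ∫ u in (0 : ℝ)..(2 * π), ((γ u).re * (deriv γ u).im - (γ u).im * (deriv γ u).re)

/-- Smooth, closed, embedded, (strictly) convex plane curves, oriented counterclockwise: the curve
lies on the left of each of its tangent lines, and its curvature is positive. -/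
structure IsConvexCurve (γ : ℝ → ℂ) : Prop where
  smooth : ContDiff ℝ ∞ γ
  closed : Function.Periodic γ (2 * π)
  regular : ∀ u, deriv γ u ≠ 0
  embedded : InjOn γ (Ico 0 (2 * π))
  left_of_tangent : ∀ u v, 0 ≤ inner ℝ (γ v - γ u) (unitNormal γ u)
  curvature_pos : ∀ u, 0 < curvature γ u

/-- The anisotropic function `φ = p'' + p`. -/
def anisotropy (p : ℝ → ℝ) (θ : ℝ) : ℝ := deriv (deriv p) θ + p θ

/-- Admissible support functions of the target curve: smooth, positive, `2π`-periodic, and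
`p'' + p > 0`. -/
structure IsAdmissible (p : ℝ → ℝ) : Prop where
  smooth : ContDiff ℝ ∞ p
  periodic : Function.Periodic p (2 * π)
  pos : ∀ θ, 0 < p θ
  anisotropy_pos : ∀ θ, 0 < anisotropy p θ

/-- The target curve, which bounds the Wulff shape of `p`: `θ ↦ -p(θ) N(θ) + p'(θ) T(θ)` with
`T(θ) = (cos θ, sin θ)` and `N(θ) = (-sin θ, cos θ)`. -/
def wulffCurve (p : ℝ → ℝ) (θ : ℝ) : ℂ :=
  -(p θ : ℂ) * ⟨-sin θ, cos θ⟩ + ((deriv p θ : ℝ) : ℂ) * ⟨cos θ, sin θ⟩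

/-- The area enclosed by the target curve. -/
def wulffArea (p : ℝ → ℝ) : ℝ := enclosedArea (wulffCurve p)

/-- The anisotropic curvature `𝒦 = φ(θ) κ`. -/
def anisoCurvature (p : ℝ → ℝ) (γ : ℝ → ℂ) (u : ℝ) : ℝ :=
  anisotropy p (tangentAngle γ u) * curvature γ u

/-- The anisotropic length `∫ p(θ) ds`. -/
def anisoLength (p : ℝ → ℝ) (γ : ℝ → ℂ) : ℝ := arcIntegral γ fun u => p (tangentAngle γ u)

/-- The nonlocal quantity `λ = ∫ p(θ) 𝒦 ^ 2 ds`. -/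
def lam (p : ℝ → ℝ) (γ : ℝ → ℂ) : ℝ :=
  arcIntegral γ fun u => p (tangentAngle γ u) * anisoCurvature p γ u ^ 2

/-- The normal speed `p(θ) (𝒦 - λ / (2 Ã))`. -/
def normalSpeed (p : ℝ → ℝ) (γ : ℝ → ℂ) (u : ℝ) : ℝ :=
  p (tangentAngle γ u) * (anisoCurvature p γ u - lam p γ / (2 * wulffArea p))

/-- The time interval `[0, T)`, where `T = ∞` is allowed. -/
def timeInterval (T : EReal) : Set ℝ := {t : ℝ | 0 ≤ t ∧ (t : EReal) < T}

/-- `X` is a smooth family of closed regular curves on `[0, T)` that starts at `X₀` and solves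
`∂X/∂t = ξ T + p(θ) (𝒦 - λ(t) / (2 Ã)) N`. -/
structure IsFlow (p : ℝ → ℝ) (X₀ : ℝ → ℂ) (T : EReal) (ξ : ℝ → ℝ → ℝ) (X : ℝ → ℝ → ℂ) :
    Prop where
  smooth : ContDiffOn ℝ ∞ (fun z : ℝ × ℝ => X z.1 z.2) (univ ×ˢ timeInterval T)
  closed : ∀ t ∈ timeInterval T, Function.Periodic (fun u => X u t) (2 * π)
  regular : ∀ t ∈ timeInterval T, ∀ u, deriv (fun v => X v t) u ≠ 0
  initial : ∀ u, X u 0 = X₀ u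
  evolution : ∀ t ∈ timeInterval T, ∀ u,
    HasDerivWithinAt (fun τ => X u τ)
      ((ξ u t : ℂ) * unitTangent (fun v => X v t) u +
        (normalSpeed p (fun v => X v t) u : ℂ) * unitNormal (fun v => X v t) u)
      (timeInterval T) t

end

end AnisotropicFlow

/-! For a family of closed curves with normal velocity `V`, the first variations are `dℒ/dt = -∫ V 𝒦
ds` and `dA/dt = -∫ V ds`; the tangential part of the velocity drops out. Both come from writing the
time derivative of the integrand as an exact `u`-derivative plus the stated term
(`hasDerivAt_anisoLength`, `hasDerivAt_enclosedArea`).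

Put `m = ∫ p 𝒦 ds = ∫ (pφ)(θ) κ ds`. Since `κ ds = dθ`, this integrates a fixed 1-form on the circle
of directions along the tangent map, so it is constant under any smooth deformation through regular
closed curves. On the convex curve `X₀` the tangent turns exactly once, so there `m = ∫₀^{2π} pφ dθ
= 2Ã`. Hence `m = 2Ã` at all times, and no convexity of the later curves has to be established.

With `V = p(𝒦 - λ/(2Ã))` this gives `dℒ/dt = -λ + (λ/(2Ã)) m = 0` and `dA/dt = (λℒ - (2Ã)²)/(2Ã)`,
which is nonnegative by Cauchy–Schwarz for the measure `p ds`: `m² ≤ λℒ`. Derivatives are taken in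
the interior of the time interval; continuity covers `t = 0`. -/

namespace AnisotropicFlow

open Topology

/-! ### Partial derivatives of maps smooth on `univ ×ˢ D` -/

section Calculus

theorem periodic_deriv {E : Type*} [NormedAddCommGroup E] [NormedSpace ℝ E] {f : ℝ → E} {c : ℝ}
    (hf : Function.Periodic f c) : Function.Periodic (deriv f) c := fun x => by
  rw [← deriv_comp_add_const, show (fun y => f (y + c)) = f from funext hf]

theorem contDiffOn_div {E : Type*} [NormedAddCommGroup E] [NormedSpace ℝ E] {f g : E → ℂ}
    {s : Set E} (hf : ContDiffOn ℝ ∞ f s) (hg : ContDiffOn ℝ ∞ g s) (h0 : ∀ x ∈ s, g x ≠ 0) :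
    ContDiffOn ℝ ∞ (fun x => f x / g x) s := by
  simp only [div_eq_mul_inv]
  exact hf.mul (hg.inv h0)

theorem contDiff_div {E : Type*} [NormedAddCommGroup E] [NormedSpace ℝ E] {f g : E → ℂ}
    (hf : ContDiff ℝ ∞ f) (hg : ContDiff ℝ ∞ g) (h0 : ∀ x, g x ≠ 0) :
    ContDiff ℝ ∞ (fun x => f x / g x) :=
  contDiffOn_univ.1 (contDiffOn_div hf.contDiffOn hg.contDiffOn fun x _ => h0 x)

/-- The derivative of a periodic function has zero mean, so it may be dropped from an integrand. -/
theorem integral_eq_of_eq_deriv_add {f g h : ℝ → ℝ} {c : ℝ} (hf : ContDiff ℝ ∞ f)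
    (hp : Function.Periodic f c) (hg : Continuous g) (he : ∀ u, g u = deriv f u + h u) :
    ∫ u in (0 : ℝ)..c, g u = ∫ u in (0 : ℝ)..c, h u := by
  have hi : IntervalIntegrable (deriv f) MeasureTheory.volume 0 c :=
    (hf.continuous_deriv (by simp)).intervalIntegrable _ _
  have h0 : ∫ u in (0 : ℝ)..c, deriv f u = 0 := by
    rw [intervalIntegral.integral_deriv_eq_sub
      (fun u _ => (hf.differentiable (by simp)).differentiableAt) hi]
    have := hp 0
    rw [zero_add] at this
    rw [this, sub_self]
  have hh : h = fun u => g u - deriv f u := funext fun u => by rw [he]; ring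
  rw [hh, intervalIntegral.integral_sub (hg.intervalIntegrable _ _) hi, h0, sub_zero]

variable {E : Type*} [NormedAddCommGroup E] [NormedSpace ℝ E] {Z : ℝ → ℝ → E} {D : Set ℝ}

theorem hasDerivAt_fst_of_hasFDerivWithinAt {u t : ℝ} {f' : ℝ × ℝ →L[ℝ] E} (ht : t ∈ D)
    (h : HasFDerivWithinAt (fun z : ℝ × ℝ => Z z.1 z.2) f' (univ ×ˢ D) (u, t)) :
    HasDerivAt (fun v => Z v t) (f' (1, 0)) u := by
  have hl : HasDerivWithinAt (fun v : ℝ => (v, t)) ((1 : ℝ), (0 : ℝ)) univ u :=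
    ((hasDerivAt_id u).prodMk (hasDerivAt_const u t)).hasDerivWithinAt
  have := h.comp_hasDerivWithinAt u hl (t := univ ×ˢ D) (fun v _ => ⟨mem_univ v, ht⟩)
  exact hasDerivWithinAt_univ.1 this

theorem hasDerivAt_snd_of_hasFDerivAt {u t : ℝ} {f' : ℝ × ℝ →L[ℝ] E}
    (h : HasFDerivAt (fun z : ℝ × ℝ => Z z.1 z.2) f' (u, t)) :
    HasDerivAt (fun τ => Z u τ) (f' (0, 1)) t := by
  have hl : HasDerivAt (fun τ : ℝ => (u, τ)) ((0 : ℝ), (1 : ℝ)) t :=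
    (hasDerivAt_const t u).prodMk (hasDerivAt_id t)
  exact h.comp_hasDerivAt t hl

/-- The slices in the first variable are full lines, so the within-derivative in the direction `(1,
0)` is an ordinary derivative. Thus `D` need not be open, and the time interval with its endpoint
`0` is allowed. -/
theorem contDiffOn_deriv_fst (hD : UniqueDiffOn ℝ D)
    (hZ : ContDiffOn ℝ ∞ (fun z : ℝ × ℝ => Z z.1 z.2) (univ ×ˢ D)) :
    ContDiffOn ℝ ∞ (fun z : ℝ × ℝ => deriv (fun v => Z v z.2) z.1) (univ ×ˢ D) := by
  have h := (hZ.fderivWithin (m := ∞) (uniqueDiffOn_univ.prod hD) (by simp)).clm_apply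
    (contDiffOn_const (c := ((1 : ℝ), (0 : ℝ))))
  refine h.congr fun z hz => ?_
  exact (hasDerivAt_fst_of_hasFDerivWithinAt hz.2
    ((hZ.differentiableOn (by simp) z hz).hasFDerivWithinAt)).deriv

theorem hasDerivAt_fst (hZ : ContDiffOn ℝ ∞ (fun z : ℝ × ℝ => Z z.1 z.2) (univ ×ˢ D))
    {t : ℝ} (ht : t ∈ D) (u : ℝ) :
    HasDerivAt (fun v => Z v t) (deriv (fun v => Z v t) u) u :=
  (hasDerivAt_fst_of_hasFDerivWithinAt ht ((hZ.differentiableOn (by simp) (u, t)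
    ⟨mem_univ _, ht⟩).hasFDerivWithinAt)).differentiableAt.hasDerivAt

theorem hasFDerivAt_of_contDiffOn (hD : IsOpen D)
    (hZ : ContDiffOn ℝ ∞ (fun z : ℝ × ℝ => Z z.1 z.2) (univ ×ˢ D))
    {z : ℝ × ℝ} (hz : z ∈ univ ×ˢ D) :
    HasFDerivAt (fun z : ℝ × ℝ => Z z.1 z.2) (fderiv ℝ (fun z : ℝ × ℝ => Z z.1 z.2) z) z :=
  ((hZ.differentiableOn (by simp) z hz).differentiableAt
    ((isOpen_univ.prod hD).mem_nhds hz)).hasFDerivAt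

theorem contDiffOn_deriv_snd (hD : IsOpen D)
    (hZ : ContDiffOn ℝ ∞ (fun z : ℝ × ℝ => Z z.1 z.2) (univ ×ˢ D)) :
    ContDiffOn ℝ ∞ (fun z : ℝ × ℝ => deriv (fun τ => Z z.1 τ) z.2) (univ ×ˢ D) := by
  have h := (hZ.fderiv_of_isOpen (m := ∞) (isOpen_univ.prod hD) (by simp)).clm_apply
    (contDiffOn_const (c := ((0 : ℝ), (1 : ℝ))))
  exact h.congr fun z hz =>
    (hasDerivAt_snd_of_hasFDerivAt (hasFDerivAt_of_contDiffOn hD hZ hz)).deriv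

theorem hasDerivAt_snd (hD : IsOpen D)
    (hZ : ContDiffOn ℝ ∞ (fun z : ℝ × ℝ => Z z.1 z.2) (univ ×ˢ D))
    {t : ℝ} (ht : t ∈ D) (u : ℝ) :
    HasDerivAt (fun τ => Z u τ) (deriv (fun τ => Z u τ) t) t :=
  (hasDerivAt_snd_of_hasFDerivAt (hasFDerivAt_of_contDiffOn (z := (u, t)) hD hZ
    ⟨mem_univ _, ht⟩)).differentiableAt.hasDerivAt

/-- Symmetry of the mixed partial derivatives. -/
theorem deriv_snd_deriv_fst (hD : IsOpen D)
    (hZ : ContDiffOn ℝ ∞ (fun z : ℝ × ℝ => Z z.1 z.2) (univ ×ˢ D))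
    {t : ℝ} (ht : t ∈ D) (u : ℝ) :
    deriv (fun τ => deriv (fun v => Z v τ) u) t = deriv (fun v => deriv (fun τ => Z v τ) t) u := by
  set f : ℝ × ℝ → E := fun z => Z z.1 z.2 with hf
  have hz : ((u, t) : ℝ × ℝ) ∈ univ ×ˢ D := ⟨mem_univ _, ht⟩
  have hop := isOpen_univ.prod hD (X := ℝ)
  have hs : IsSymmSndFDerivAt ℝ f (u, t) :=
    (hZ.contDiffAt (hop.mem_nhds hz)).isSymmSndFDerivAt (by
      simpa using WithTop.coe_le_coe.2 (le_top : (2 : ℕ∞) ≤ ⊤))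
  have h2 : HasFDerivAt (fderiv ℝ f) (fderiv ℝ (fderiv ℝ f) (u, t)) (u, t) :=
    (((hZ.fderiv_of_isOpen (m := ∞) hop (by simp)).differentiableOn (by simp) _ hz
      ).differentiableAt (hop.mem_nhds hz)).hasFDerivAt
  have h1 : HasDerivAt (fun τ => fderiv ℝ f (u, τ) (1, 0))
      (fderiv ℝ (fderiv ℝ f) (u, t) (0, 1) (1, 0)) t :=
    hasDerivAt_snd_of_hasFDerivAt (Z := fun v τ => fderiv ℝ f (v, τ) (1, 0))
      (f' := (fderiv ℝ (fderiv ℝ f) (u, t)).flip (1, 0)) (by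
        simpa using h2.clm_apply (hasFDerivAt_const ((1 : ℝ), (0 : ℝ)) (u, t)))
  have h3 : HasDerivAt (fun v => fderiv ℝ f (v, t) (0, 1))
      (fderiv ℝ (fderiv ℝ f) (u, t) (1, 0) (0, 1)) u :=
    hasDerivAt_fst_of_hasFDerivWithinAt (Z := fun v τ => fderiv ℝ f (v, τ) (0, 1))
      (f' := (fderiv ℝ (fderiv ℝ f) (u, t)).flip (0, 1)) ht (by
        simpa using (h2.clm_apply (hasFDerivAt_const ((0 : ℝ), (1 : ℝ)) (u, t))).hasFDerivWithinAt)
  have e1 : (fun τ => deriv (fun v => Z v τ) u) =ᶠ[𝓝 t] fun τ => fderiv ℝ f (u, τ) (1, 0) := by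
    filter_upwards [hD.mem_nhds ht] with τ hτ
    exact (hasDerivAt_fst_of_hasFDerivWithinAt hτ
      (hasFDerivAt_of_contDiffOn hD hZ (z := (u, τ)) ⟨mem_univ _, hτ⟩).hasFDerivWithinAt).deriv
  have e2 : (fun v => deriv (fun τ => Z v τ) t) = fun v => fderiv ℝ f (v, t) (0, 1) := by
    funext v
    exact (hasDerivAt_snd_of_hasFDerivAt
      (hasFDerivAt_of_contDiffOn hD hZ (z := (v, t)) ⟨mem_univ _, ht⟩)).deriv
  rw [e1.deriv_eq, e2, h1.deriv, h3.deriv]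
  exact hs.eq _ _

theorem contDiff_slice (hZ : ContDiffOn ℝ ∞ (fun z : ℝ × ℝ => Z z.1 z.2) (univ ×ˢ D))
    {t : ℝ} (ht : t ∈ D) : ContDiff ℝ ∞ fun u => Z u t :=
  contDiffOn_univ.1 <| hZ.comp (contDiff_id.prodMk contDiff_const).contDiffOn
    (fun _ _ => ⟨mem_univ _, ht⟩)

theorem contDiff_deriv_snd_slice (hD : IsOpen D)
    (hZ : ContDiffOn ℝ ∞ (fun z : ℝ × ℝ => Z z.1 z.2) (univ ×ˢ D)) {t : ℝ} (ht : t ∈ D) :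
    ContDiff ℝ ∞ fun u => deriv (fun τ => Z u τ) t :=
  contDiff_slice (Z := fun u t => deriv (fun τ => Z u τ) t) (contDiffOn_deriv_snd hD hZ) ht

end Calculus

/-! ### Integrals depending on time -/

section Parametric

variable {G : ℝ → ℝ → ℝ} {D : Set ℝ}

theorem continuousOn_parametric_integral
    (hG : ContDiffOn ℝ ∞ (fun z : ℝ × ℝ => G z.1 z.2) (univ ×ˢ D)) (a b : ℝ) :
    ContinuousOn (fun t => ∫ u in a..b, G u t) D := by
  rw [continuousOn_iff_continuous_domRestrict]
  refine intervalIntegral.continuous_parametric_intervalIntegral_of_continuous'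
    (f := fun (t : D) u => G u t) ?_ a b
  exact hG.continuousOn.comp_continuous (f := fun q : D × ℝ => (q.2, (q.1 : ℝ)))
    (by fun_prop) fun q => ⟨mem_univ _, q.1.2⟩

theorem hasDerivAt_parametric_integral (hD : IsOpen D)
    (hG : ContDiffOn ℝ ∞ (fun z : ℝ × ℝ => G z.1 z.2) (univ ×ˢ D)) (a b : ℝ) {t : ℝ}
    (ht : t ∈ D) :
    HasDerivAt (fun t => ∫ u in a..b, G u t) (∫ u in a..b, deriv (fun τ => G u τ) t) t := by
  obtain ⟨ε, hε, hball⟩ := Metric.nhds_basis_closedBall.mem_iff.1 (hD.mem_nhds ht)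
  have hG' := contDiffOn_deriv_snd hD hG
  -- The dominating function is a constant: the maximum of the time derivative over a compact
  -- rectangle.
  obtain ⟨C, hC⟩ := (isCompact_uIcc.prod (isCompact_closedBall t ε)).exists_bound_of_continuousOn
    (f := fun z : ℝ × ℝ => deriv (fun τ => G z.1 τ) z.2) (s := uIcc a b ×ˢ Metric.closedBall t ε)
    (hG'.continuousOn.mono (prod_mono (subset_univ _) hball))
  refine (intervalIntegral.hasDerivAt_integral_of_dominated_loc_of_deriv_le
    (F := fun t u => G u t) (F' := fun t u => deriv (fun τ => G u τ) t) (bound := fun _ => C)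
    (Metric.closedBall_mem_nhds t hε) ?_ ?_ ?_ ?_ (by simp) ?_).2
  · filter_upwards [hD.mem_nhds ht] with τ hτ
    exact (contDiff_slice hG hτ).continuous.aestronglyMeasurable
  · exact (contDiff_slice hG ht).continuous.intervalIntegrable _ _
  · exact (contDiff_slice hG' ht).continuous.aestronglyMeasurable
  · exact .of_forall fun u hu τ hτ => hC (u, τ) ⟨uIoc_subset_uIcc hu, hτ⟩
  · exact .of_forall fun u _ τ hτ => hasDerivAt_snd hD hG (hball hτ) u

end Parametric

/-! ### Functions of the tangent angle, insensitive to the branch cut of `arg` -/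

section Angle

variable {F : ℝ → ℝ} {c : ℝ → ℂ} {c' : ℂ} {x : ℝ}

theorem periodic_comp_arg_eq (hF : Function.Periodic F (2 * π)) {r θ : ℝ} (hr : 0 < r) {z : ℂ}
    (hz : z = r * Complex.exp (θ * Complex.I)) : F (Complex.arg z) = F θ := by
  have h : (Complex.arg z : Real.Angle) = θ := by
    rw [hz, Complex.exp_mul_I]
    simpa using Complex.arg_mul_cos_add_sin_mul_I_coe_angle hr θ
  obtain ⟨k, hk⟩ := Real.Angle.angle_eq_iff_two_pi_dvd_sub.1 h
  have : Complex.arg z = θ + k * (2 * π) := by linarith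
  rw [this]
  exact hF.int_mul k θ

theorem eq_norm_mul_exp_log {z : ℂ} (hz : z ≠ 0) (w : ℂ) :
    w = ‖w‖ * Complex.exp ((Complex.arg z + (Complex.log (w / z)).im : ℝ) * Complex.I) := by
  have h1 := Complex.norm_mul_exp_arg_mul_I z
  have h2 := Complex.norm_mul_exp_arg_mul_I (w / z)
  rw [Complex.log_im]
  push_cast
  rw [add_mul, Complex.exp_add]
  have hn : (‖w‖ : ℂ) = ‖z‖ * ‖w / z‖ := by
    rw [← Complex.ofReal_mul, ← norm_mul, mul_div_cancel₀ _ hz]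
  calc w = z * (w / z) := (mul_div_cancel₀ _ hz).symm
    _ = (‖z‖ * Complex.exp (z.arg * Complex.I)) *
        (‖w / z‖ * Complex.exp ((w / z).arg * Complex.I)) := by rw [h1, h2]
    _ = _ := by rw [hn]; ring

/-- Measuring the angle from the direction of `z` moves the branch cut away from `z`: `(log (w /
z)).im` is smooth in `w` near `z`, even when `z` lies on the negative axis. -/
theorem periodic_comp_arg_eq_log (hF : Function.Periodic F (2 * π)) {z w : ℂ} (hz : z ≠ 0)
    (hw : w ≠ 0) : F (Complex.arg w) = F (Complex.arg z + (Complex.log (w / z)).im) :=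
  periodic_comp_arg_eq hF (norm_pos_iff.2 hw) (eq_norm_mul_exp_log hz w)

theorem contDiffAt_comp_arg (hF : Function.Periodic F (2 * π)) (hF' : ContDiff ℝ ∞ F) {z : ℂ}
    (hz : z ≠ 0) : ContDiffAt ℝ ∞ (fun w => F (Complex.arg w)) z := by
  have h1 : ContDiffAt ℝ ∞ (fun w => Complex.log (w / z)) z := by
    have hl : ContDiffAt ℝ ∞ Complex.log (z / z) := by
      refine (Complex.contDiffAt_log ?_).restrict_scalars ℝ
      rw [div_self hz]; exact Complex.one_mem_slitPlane
    exact ContDiffAt.comp z (f := fun w => w / z) hl (contDiffAt_id.div_const z)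
  have h2 : ContDiffAt ℝ ∞ (fun w => F (Complex.arg z + (Complex.log (w / z)).im)) z :=
    hF'.contDiffAt.comp z (contDiffAt_const.add (Complex.imCLM.contDiff.contDiffAt.comp z h1))
  refine h2.congr_of_eventuallyEq ?_
  filter_upwards [isOpen_ne.mem_nhds hz] with w hw
  exact periodic_comp_arg_eq_log hF hz hw

/-- The logarithmic derivative `c' / c` controls what follows: its real part is the growth rate of
`log ‖c‖`, its imaginary part the rotation speed of the direction of `c`. -/
theorem hasDerivAt_log_div (hc : HasDerivAt c c' x) (hx : c x ≠ 0) :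
    HasDerivAt (fun y => Complex.log (c y / c x)) (c' / c x) x := by
  have := (hc.div_const (c x)).clog_real (by
    rw [div_self hx]; exact Complex.one_mem_slitPlane)
  simpa [div_self hx] using this

theorem hasDerivAt_log_div_im (hc : HasDerivAt c c' x) (hx : c x ≠ 0) :
    HasDerivAt (fun y => (Complex.log (c y / c x)).im) (c' / c x).im x :=
  Complex.imCLM.hasFDerivAt.comp_hasDerivAt x (hasDerivAt_log_div hc hx)

theorem hasDerivAt_comp_arg (hF : Function.Periodic F (2 * π)) {F' : ℝ} (hc : HasDerivAt c c' x)
    (hx : c x ≠ 0) (hF' : HasDerivAt F F' (Complex.arg (c x))) :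
    HasDerivAt (fun y => F (Complex.arg (c y))) (F' * (c' / c x).im) x := by
  have h1 := (hasDerivAt_log_div_im hc hx).const_add (Complex.arg (c x))
  have h2 : HasDerivAt (fun y => F (Complex.arg (c x) + (Complex.log (c y / c x)).im))
      (F' * (c' / c x).im) x :=
    HasDerivAt.comp x (h₂ := F) (by simpa [div_self hx] using hF') h1
  refine h2.congr_of_eventuallyEq ?_
  filter_upwards [hc.continuousAt.eventually_ne hx] with y hy
  exact periodic_comp_arg_eq_log hF hx hy

theorem hasDerivAt_norm (hc : HasDerivAt c c' x) (hx : c x ≠ 0) :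
    HasDerivAt (fun y => ‖c y‖) (‖c x‖ * (c' / c x).re) x := by
  have h1 : HasDerivAt (fun y => (Complex.log (c y / c x)).re) (c' / c x).re x :=
    Complex.reCLM.hasFDerivAt.comp_hasDerivAt x (hasDerivAt_log_div hc hx)
  have h2 := h1.exp.const_mul ‖c x‖
  simp only [div_self hx, Complex.log_one, Complex.zero_re, Real.exp_zero, one_mul] at h2
  refine h2.congr_of_eventuallyEq ?_
  filter_upwards [hc.continuousAt.eventually_ne hx] with y hy
  have : 0 < ‖c y / c x‖ := norm_pos_iff.2 (div_ne_zero hy hx)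
  rw [Complex.log_re, Real.exp_log this, ← norm_mul, mul_div_cancel₀ _ hx]

theorem hasDerivAt_div_norm (hc : HasDerivAt c c' x) (hx : c x ≠ 0) :
    HasDerivAt (fun y => c y / (‖c y‖ : ℂ))
      (Complex.I * (c x / (‖c x‖ : ℂ)) * ((c' / c x).im : ℂ)) x := by
  have hn : (‖c x‖ : ℂ) ≠ 0 := by simpa using hx
  have h := hc.div (hasDerivAt_norm hc hx).ofReal_comp hn
  refine h.congr_deriv ?_
  clear h
  -- With `c' = q c` the claim reduces to `q - Re q = i Im q`.
  obtain ⟨q, rfl⟩ : ∃ q, c' = q * c x := ⟨c' / c x, (div_mul_cancel₀ _ hx).symm⟩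
  rw [mul_div_cancel_right₀ _ hx]
  have := Complex.re_add_im q
  field_simp
  push_cast
  linear_combination (-(‖c x‖ : ℂ)) * this

end Angle

/-- This is `κ ds = dθ`: the right side is the rotation speed of `γ'`. -/
theorem curvature_mul_speed {γ : ℝ → ℂ} {u : ℝ} (h : deriv γ u ≠ 0) :
    curvature γ u * speed γ u = (deriv (deriv γ) u / deriv γ u).im := by
  have hn : ‖deriv γ u‖ ≠ 0 := norm_ne_zero_iff.2 h
  rw [curvature, speed, Complex.div_im, Complex.normSq_eq_norm_sq]
  field_simp

/-! ### A convex curve has turning number one -/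

section Convex

variable {γ : ℝ → ℂ}

theorem IsConvexCurve.contDiff_deriv (h : IsConvexCurve γ) : ContDiff ℝ ∞ (deriv γ) :=
  (contDiff_infty_iff_deriv.1 h.smooth).2

theorem IsConvexCurve.continuous_curvature_mul_speed (h : IsConvexCurve γ) :
    Continuous fun u => curvature γ u * speed γ u := by
  simp_rw [curvature_mul_speed (h.regular _)]
  exact Complex.continuous_im.comp ((h.contDiff_deriv.continuous_deriv (by simp)).div
    h.contDiff_deriv.continuous h.regular)

theorem IsConvexCurve.hasDerivAt_unitTangent (h : IsConvexCurve γ) (u : ℝ) :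
    HasDerivAt (unitTangent γ)
      (Complex.I * unitTangent γ u * ((curvature γ u * speed γ u : ℝ) : ℂ)) u := by
  rw [curvature_mul_speed (h.regular u)]
  exact hasDerivAt_div_norm
    ((h.contDiff_deriv.differentiable (by simp)).differentiableAt.hasDerivAt) (h.regular u)

theorem speed_pos {u : ℝ} (h : deriv γ u ≠ 0) : 0 < speed γ u := norm_pos_iff.2 h

theorem deriv_eq_speed_mul {u : ℝ} (h : deriv γ u ≠ 0) :
    deriv γ u = speed γ u * unitTangent γ u :=
  (mul_div_cancel₀ _ (by exact_mod_cast (speed_pos h).ne')).symm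

theorem norm_unitTangent {u : ℝ} (h : deriv γ u ≠ 0) : ‖unitTangent γ u‖ = 1 := by
  rw [unitTangent, norm_div, speed, Complex.norm_real, norm_norm,
    div_self (norm_ne_zero_iff.2 h)]

/-- On a strictly convex curve the tangent directions at distinct points are distinct. -/
theorem IsConvexCurve.injOn_unitTangent (h : IsConvexCurve γ) :
    InjOn (unitTangent γ) (Ico 0 (2 * π)) := by
  intro u hu v hv huv
  -- With equal normals at `u` and `v`, the two support inequalities are opposite, so `γ v - γ u` is
  -- tangential.
  have h1 := h.left_of_tangent u v
  have h2 := h.left_of_tangent v u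
  rw [unitNormal] at h1
  rw [unitNormal, ← huv, ← neg_sub, inner_neg_left] at h2
  have hn : inner ℝ (γ v - γ u) (Complex.I * unitTangent γ u) = 0 := by linarith
  have hγ : HasDerivAt γ (deriv γ u) u :=
    ((h.smooth.differentiable (by simp)).differentiableAt).hasDerivAt
  have hd := (hγ.const_sub (γ v)).inner ℝ ((h.hasDerivAt_unitTangent u).const_mul Complex.I)
  -- The signed distance from `γ v` to the moving tangent line is nonnegative and vanishes at `u`.
  -- Its derivative there is `-κ g ⟨γ v - γ u, T⟩`, so the tangential component vanishes too; hence
  -- `γ v = γ u`, against embeddedness unless `u = v`.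
  have hmin : IsLocalMin (fun w => inner ℝ (γ v - γ w) (Complex.I * unitTangent γ w)) u :=
    .of_forall fun w => hn.trans_le (h.left_of_tangent w v)
  have h0 := hmin.hasDerivAt_eq_zero hd
  have hk : 0 < curvature γ u * speed γ u := mul_pos (h.curvature_pos u) (speed_pos (h.regular u))
  have hT := norm_unitTangent (h.regular u)
  rw [deriv_eq_speed_mul (h.regular u)] at h0
  rw [← sq_eq_sq₀ (norm_nonneg _) zero_le_one, ← Complex.normSq_eq_norm_sq,
    Complex.normSq_apply] at hT
  refine h.embedded hu hv (sub_eq_zero.1 ?_).symm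
  generalize curvature γ u * speed γ u = k at *
  generalize γ v - γ u = d at *
  generalize unitTangent γ u = τ at *
  generalize speed γ u = g at *
  simp only [Complex.inner, Complex.mul_re, Complex.mul_im, Complex.conj_re, Complex.conj_im,
    Complex.I_re, Complex.I_im, Complex.ofReal_re, Complex.ofReal_im, Complex.neg_re,
    Complex.neg_im] at h0 hn
  have hp : d.re * τ.re + d.im * τ.im = 0 := by
    refine (mul_eq_zero.1 (?_ : k * (d.re * τ.re + d.im * τ.im) = 0)).resolve_left hk.ne'
    linarith
  apply Complex.ext
  · rw [Complex.zero_re]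
    linear_combination τ.re * hp - τ.im * hn - d.re * hT
  · rw [Complex.zero_im]
    linear_combination τ.im * hp + τ.re * hn - d.im * hT

/-- The tangent angle of a convex curve has a differentiable lift that increases by `2π` over one
period. -/
theorem IsConvexCurve.exists_angle_lift (h : IsConvexCurve γ) :
    ∃ θ : ℝ → ℝ, (∀ u, HasDerivAt θ (curvature γ u * speed γ u) u) ∧
      (∀ u, unitTangent γ u = Complex.exp (θ u * Complex.I)) ∧ θ (2 * π) = θ 0 + 2 * π := by
  have hkc := h.continuous_curvature_mul_speed
  set θ : ℝ → ℝ := fun u =>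
    Complex.arg (deriv γ 0) + ∫ s in (0 : ℝ)..u, curvature γ s * speed γ s with hθ
  have hθd : ∀ u, HasDerivAt θ (curvature γ u * speed γ u) u := fun u =>
    (hkc.integral_hasStrictDerivAt 0 u).hasDerivAt.const_add _
  have hT : ∀ u, unitTangent γ u = Complex.exp (θ u * Complex.I) := by
    -- `T` and `exp (iθ)` solve the same linear equation `y' = i κ g y`, so their quotient is
    -- constant.
    have hq : ∀ u, HasDerivAt (fun u => unitTangent γ u * Complex.exp (-(θ u * Complex.I))) 0 u := by
      intro u
      have := (h.hasDerivAt_unitTangent u).mul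
        (((hθd u).ofReal_comp.mul_const Complex.I).neg.cexp)
      refine this.congr_deriv ?_
      ring
    intro u
    have hc := is_const_of_deriv_eq_zero (fun u => (hq u).differentiableAt)
      (fun u => (hq u).deriv) u 0
    have h0 : unitTangent γ 0 * Complex.exp (-(θ 0 * Complex.I)) = 1 := by
      have : unitTangent γ 0 = Complex.exp (θ 0 * Complex.I) := by
        rw [unitTangent, div_eq_iff (by exact_mod_cast (speed_pos (h.regular 0)).ne')]
        simp only [hθ, intervalIntegral.integral_same, add_zero]
        rw [mul_comm]
        exact (Complex.norm_mul_exp_arg_mul_I _).symm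
      rw [this, ← Complex.exp_add, add_neg_cancel, Complex.exp_zero]
    rw [h0, Complex.exp_neg] at hc
    exact (mul_inv_eq_one₀ (Complex.exp_ne_zero _)).1 hc
  have hmono : StrictMono θ := strictMono_of_deriv_pos fun u => by
    rw [(hθd u).deriv]; exact mul_pos (h.curvature_pos u) (speed_pos (h.regular u))
  refine ⟨θ, hθd, hT, ?_⟩
  have hper : unitTangent γ (2 * π) = unitTangent γ 0 := by
    have : deriv γ (2 * π) = deriv γ 0 := by
      have := periodic_deriv h.closed 0
      simpa using this
    simp only [unitTangent, speed, this]
  rw [hT, hT, Complex.exp_eq_exp_iff_exists_int] at hper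
  obtain ⟨n, hn⟩ := hper
  have hn' : θ (2 * π) = θ 0 + n * (2 * π) := by
    have := congrArg Complex.im hn
    simpa [mul_comm] using this
  have hlt : θ 0 < θ (2 * π) := hmono (by positivity)
  have hn1 : 1 ≤ n := by
    by_contra! hcon
    have : (n : ℝ) ≤ 0 := by exact_mod_cast Int.lt_add_one_iff.1 hcon
    nlinarith [Real.pi_pos]
  rcases hn1.eq_or_lt with rfl | hn2
  · simpa using hn'
  exfalso
  have h2 : (2 : ℝ) ≤ n := by exact_mod_cast hn2
  have hθc : Continuous θ := continuous_iff_continuousAt.2 fun u => (hθd u).continuousAt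
  -- With two or more turns, the angle `θ 0 + 2π` would be reached strictly inside the period,
  -- repeating the tangent direction at `0`.
  obtain ⟨v, hv, hvθ⟩ := intermediate_value_Icc (by positivity : (0 : ℝ) ≤ 2 * π)
    hθc.continuousOn (show θ 0 + 2 * π ∈ Icc (θ 0) (θ (2 * π)) by
      constructor <;> nlinarith [Real.pi_pos])
  have hv0 : 0 < v := hmono.lt_iff_lt.1 (by rw [hvθ]; linarith [Real.pi_pos])
  have hv1 : v < 2 * π := hmono.lt_iff_lt.1 (by rw [hvθ, hn']; nlinarith [Real.pi_pos])
  refine hv0.ne (h.injOn_unitTangent ⟨le_rfl, by positivity⟩ ⟨hv0.le, hv1⟩ ?_)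
  rw [hT, hT, hvθ]
  push_cast
  rw [add_mul, Complex.exp_add, Complex.exp_two_pi_mul_I, mul_one]

/-- Change of variables `dθ = κ ds` on a convex curve. -/
theorem IsConvexCurve.arcIntegral_comp_tangentAngle_mul_curvature (h : IsConvexCurve γ) {F : ℝ → ℝ}
    (hF : Function.Periodic F (2 * π)) (hFc : Continuous F) :
    arcIntegral γ (fun u => F (tangentAngle γ u) * curvature γ u) =
      ∫ θ in (0 : ℝ)..(2 * π), F θ := by
  obtain ⟨θ, hθ, hT, h2⟩ := h.exists_angle_lift
  have hkc := h.continuous_curvature_mul_speed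
  have he : ∀ u, F (tangentAngle γ u) = F (θ u) := fun u =>
    periodic_comp_arg_eq hF (speed_pos (h.regular u)) (by
      rw [← hT]; exact deriv_eq_speed_mul (h.regular u))
  have := intervalIntegral.integral_comp_mul_deriv (a := 0) (b := 2 * π) (g := F)
    (fun u _ => hθ u) hkc.continuousOn hFc
  rw [h2, hF.intervalIntegral_add_eq (θ 0) 0, zero_add] at this
  rw [← this, arcIntegral]
  simp only [he, Function.comp_apply, mul_assoc]

end Convex

/-! ### The area of the Wulff shape -/

section Wulff

variable {p : ℝ → ℝ}

theorem IsAdmissible.contDiff_deriv (hp : IsAdmissible p) : ContDiff ℝ ∞ (deriv p) :=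
  (contDiff_infty_iff_deriv.1 hp.smooth).2

theorem IsAdmissible.contDiff_anisotropy (hp : IsAdmissible p) : ContDiff ℝ ∞ (anisotropy p) :=
  (contDiff_infty_iff_deriv.1 hp.contDiff_deriv).2.add hp.smooth

theorem IsAdmissible.periodic_anisotropy (hp : IsAdmissible p) :
    Function.Periodic (anisotropy p) (2 * π) := fun θ => by
  rw [anisotropy, anisotropy, periodic_deriv (periodic_deriv hp.periodic) θ, hp.periodic θ]

/-- The derivative of `-pN + p'T` is `φT`, because the terms in `p'N` cancel. The area integrand is
therefore `det (-pN + p'T, φT) = pφ`. -/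
theorem IsAdmissible.two_mul_wulffArea (hp : IsAdmissible p) :
    2 * wulffArea p = ∫ θ in (0 : ℝ)..(2 * π), p θ * anisotropy p θ := by
  rw [wulffArea, enclosedArea, ← mul_assoc, mul_one_div_cancel two_ne_zero, one_mul]
  refine intervalIntegral.integral_congr fun θ _ => ?_
  have hp0 : HasDerivAt p (deriv p θ) θ :=
    (hp.smooth.differentiable (by simp)).differentiableAt.hasDerivAt
  have hp1 : HasDerivAt (deriv p) (deriv (deriv p) θ) θ :=
    (hp.contDiff_deriv.differentiable (by simp)).differentiableAt.hasDerivAt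
  have hform : wulffCurve p = fun θ => ((p θ * sin θ + deriv p θ * cos θ : ℝ) : ℂ) +
      ((-(p θ * cos θ) + deriv p θ * sin θ : ℝ) : ℂ) * Complex.I := by
    funext θ
    apply Complex.ext <;> simp [wulffCurve, -Complex.ofReal_sin, -Complex.ofReal_cos]
  have hd : HasDerivAt (wulffCurve p) (((anisotropy p θ * cos θ : ℝ) : ℂ) +
      ((anisotropy p θ * sin θ : ℝ) : ℂ) * Complex.I) θ := by
    rw [hform]
    have h1 := ((hp0.mul (hasDerivAt_sin θ)).add (hp1.mul (hasDerivAt_cos θ))).ofReal_comp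
    have h2 := ((hp0.mul (hasDerivAt_cos θ)).neg.add (hp1.mul (hasDerivAt_sin θ))).ofReal_comp
    refine (h1.add (h2.mul_const Complex.I)).congr_deriv ?_
    simp only [anisotropy]
    push_cast
    ring
  rw [hd.deriv, hform]
  simp only [Complex.add_re, Complex.add_im, Complex.mul_re, Complex.mul_im, Complex.ofReal_re,
    Complex.ofReal_im, Complex.I_re, Complex.I_im]
  linear_combination p θ * anisotropy p θ * sin_sq_add_cos_sq θ

theorem IsAdmissible.wulffArea_pos (hp : IsAdmissible p) : 0 < wulffArea p := by
  have : 0 < 2 * wulffArea p := by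
    rw [hp.two_mul_wulffArea]
    exact intervalIntegral.intervalIntegral_pos_of_pos
      ((hp.smooth.continuous.mul hp.contDiff_anisotropy.continuous).intervalIntegrable _ _)
      (fun θ => mul_pos (hp.pos θ) (hp.anisotropy_pos θ)) (by positivity)
  linarith

end Wulff

/-! ### First variation formulas -/

section Variation

variable {Z : ℝ → ℝ → ℂ} {D : Set ℝ} {p F : ℝ → ℝ}

theorem contDiffOn_area_integrand (hD : UniqueDiffOn ℝ D)
    (hZ : ContDiffOn ℝ ∞ (fun z : ℝ × ℝ => Z z.1 z.2) (univ ×ˢ D)) :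
    ContDiffOn ℝ ∞ (fun z : ℝ × ℝ => (Z z.1 z.2).re * (deriv (fun v => Z v z.2) z.1).im -
      (Z z.1 z.2).im * (deriv (fun v => Z v z.2) z.1).re) (univ ×ˢ D) := by
  have h := contDiffOn_deriv_fst hD hZ
  exact ((Complex.reCLM.contDiff.comp_contDiffOn hZ).mul
    (Complex.imCLM.contDiff.comp_contDiffOn h)).sub
    ((Complex.imCLM.contDiff.comp_contDiffOn hZ).mul (Complex.reCLM.contDiff.comp_contDiffOn h))

theorem contDiffOn_comp_tangentAngle (hD : UniqueDiffOn ℝ D)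
    (hZ : ContDiffOn ℝ ∞ (fun z : ℝ × ℝ => Z z.1 z.2) (univ ×ˢ D))
    (hreg : ∀ t ∈ D, ∀ u, deriv (fun v => Z v t) u ≠ 0) (hF : Function.Periodic F (2 * π))
    (hFs : ContDiff ℝ ∞ F) :
    ContDiffOn ℝ ∞ (fun z : ℝ × ℝ => F (tangentAngle (fun v => Z v z.2) z.1)) (univ ×ˢ D) :=
  fun z hz => ContDiffAt.comp_contDiffWithinAt z (g := fun w => F (Complex.arg w))
    (contDiffAt_comp_arg hF hFs (hreg z.2 hz.2 z.1)) (contDiffOn_deriv_fst hD hZ z hz)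

theorem contDiffOn_length_integrand (hD : UniqueDiffOn ℝ D)
    (hZ : ContDiffOn ℝ ∞ (fun z : ℝ × ℝ => Z z.1 z.2) (univ ×ˢ D))
    (hreg : ∀ t ∈ D, ∀ u, deriv (fun v => Z v t) u ≠ 0) (hF : Function.Periodic F (2 * π))
    (hFs : ContDiff ℝ ∞ F) :
    ContDiffOn ℝ ∞ (fun z : ℝ × ℝ => F (tangentAngle (fun v => Z v z.2) z.1) *
      speed (fun v => Z v z.2) z.1) (univ ×ˢ D) :=
  (contDiffOn_comp_tangentAngle hD hZ hreg hF hFs).mul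
    ((contDiffOn_deriv_fst hD hZ).norm ℝ fun z hz => hreg z.2 hz.2 z.1)

theorem contDiffOn_turning_integrand (hD : UniqueDiffOn ℝ D)
    (hZ : ContDiffOn ℝ ∞ (fun z : ℝ × ℝ => Z z.1 z.2) (univ ×ˢ D))
    (hreg : ∀ t ∈ D, ∀ u, deriv (fun v => Z v t) u ≠ 0) (hF : Function.Periodic F (2 * π))
    (hFs : ContDiff ℝ ∞ F) :
    ContDiffOn ℝ ∞ (fun z : ℝ × ℝ => F (tangentAngle (fun v => Z v z.2) z.1) *
      (deriv (deriv fun v => Z v z.2) z.1 / deriv (fun v => Z v z.2) z.1).im) (univ ×ˢ D) := by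
  have h1 := contDiffOn_deriv_fst hD hZ
  have h2 : ContDiffOn ℝ ∞ (fun z : ℝ × ℝ => deriv (deriv fun v => Z v z.2) z.1) (univ ×ˢ D) :=
    contDiffOn_deriv_fst (Z := fun u t => deriv (fun v => Z v t) u) hD h1
  have h3 := Complex.imCLM.contDiff.comp_contDiffOn (contDiffOn_div h2 h1
    fun z hz => hreg z.2 hz.2 z.1)
  exact (contDiffOn_comp_tangentAngle hD hZ hreg hF hFs).mul h3

theorem arcIntegral_mul_curvature {γ : ℝ → ℂ} (hreg : ∀ u, deriv γ u ≠ 0) (f : ℝ → ℝ) :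
    arcIntegral γ (fun u => f u * curvature γ u) =
      ∫ u in (0 : ℝ)..(2 * π), f u * (deriv (deriv γ) u / deriv γ u).im := by
  rw [arcIntegral]
  refine intervalIntegral.integral_congr fun u _ => ?_
  simp only [mul_assoc]
  rw [curvature_mul_speed (hreg u)]

theorem periodic_deriv_snd (hD : IsOpen D)
    (hper : ∀ t ∈ D, Function.Periodic (fun u => Z u t) (2 * π)) {t : ℝ} (ht : t ∈ D) :
    Function.Periodic (fun u => deriv (fun τ => Z u τ) t) (2 * π) := fun u => by
  refine Filter.EventuallyEq.deriv_eq ?_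
  filter_upwards [hD.mem_nhds ht] with τ hτ using hper τ hτ u

theorem hasDerivAt_snd_deriv (hD : IsOpen D)
    (hZ : ContDiffOn ℝ ∞ (fun z : ℝ × ℝ => Z z.1 z.2) (univ ×ˢ D)) {t : ℝ} (ht : t ∈ D) (u : ℝ) :
    HasDerivAt (fun τ => deriv (fun v => Z v τ) u) (deriv (fun v => deriv (fun τ => Z v τ) t) u)
      t := by
  rw [← deriv_snd_deriv_fst hD hZ ht]
  exact hasDerivAt_snd (Z := fun u t => deriv (fun v => Z v t) u) hD
    (contDiffOn_deriv_fst hD.uniqueDiffOn hZ) ht u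

theorem hasDerivAt_snd_deriv_deriv (hD : IsOpen D)
    (hZ : ContDiffOn ℝ ∞ (fun z : ℝ × ℝ => Z z.1 z.2) (univ ×ˢ D)) {t : ℝ} (ht : t ∈ D) (u : ℝ) :
    HasDerivAt (fun τ => deriv (deriv fun v => Z v τ) u)
      (deriv (deriv fun v => deriv (fun τ => Z v τ) t) u) t := by
  have h := hasDerivAt_snd_deriv (Z := fun u t => deriv (fun v => Z v t) u) hD
    (contDiffOn_deriv_fst hD.uniqueDiffOn hZ) ht u
  rwa [show (fun v => deriv (fun τ => deriv (fun v => Z v τ) v) t) =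
    deriv (fun v => deriv (fun τ => Z v τ) t) from
      funext fun v => deriv_snd_deriv_fst hD hZ ht v] at h

/-- First variation of the enclosed area. -/
theorem hasDerivAt_enclosedArea (hD : IsOpen D)
    (hZ : ContDiffOn ℝ ∞ (fun z : ℝ × ℝ => Z z.1 z.2) (univ ×ˢ D))
    (hper : ∀ t ∈ D, Function.Periodic (fun u => Z u t) (2 * π))
    (hreg : ∀ t ∈ D, ∀ u, deriv (fun v => Z v t) u ≠ 0) {t : ℝ} (ht : t ∈ D) :
    HasDerivAt (fun τ => enclosedArea fun u => Z u τ)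
      (-arcIntegral (fun u => Z u t) fun u =>
        inner ℝ (deriv (fun τ => Z u τ) t) (unitNormal (fun u => Z u t) u)) t := by
  have hG := contDiffOn_area_integrand hD.uniqueDiffOn hZ
  have hY := contDiff_deriv_snd_slice hD hZ ht
  have hGt := (contDiff_deriv_snd_slice (Z := fun u τ => (Z u τ).re * (deriv (fun v => Z v τ) u).im -
    (Z u τ).im * (deriv (fun v => Z v τ) u).re) hD hG ht).continuous
  have hγ := contDiff_slice hZ ht
  refine ((hasDerivAt_parametric_integral hD hG 0 (2 * π) ht).const_mul (1 / 2)).congr_deriv ?_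
  rw [arcIntegral, ← intervalIntegral.integral_neg, one_div, inv_mul_eq_iff_eq_mul₀ two_ne_zero,
    ← intervalIntegral.integral_const_mul]
  set Y : ℝ → ℂ := fun u => deriv (fun τ => Z u τ) t
  -- Subtracting `∂_u det (Z, Y)` from `∂_t det (Z, Z_u)` leaves `2 det (Y, Z_u)`, which is `-2 ⟨Y,
  -- N⟩ g`.
  refine integral_eq_of_eq_deriv_add
    (f := fun u => (Z u t).re * (Y u).im - (Z u t).im * (Y u).re) ?_ (fun u => ?_)
    hGt fun u => ?_
  · exact ((Complex.reCLM.contDiff.comp hγ).mul (Complex.imCLM.contDiff.comp hY)).sub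
      ((Complex.imCLM.contDiff.comp hγ).mul (Complex.reCLM.contDiff.comp hY))
  · have h1 : Z (u + 2 * π) t = Z u t := hper t ht u
    have h2 : Y (u + 2 * π) = Y u := periodic_deriv_snd hD hper ht u
    simp only [h1, h2]
  · have d1 : HasDerivAt (fun τ => Z u τ) (Y u) t := hasDerivAt_snd hD hZ ht u
    have d2 : HasDerivAt (fun τ => deriv (fun v => Z v τ) u) (deriv Y u) t :=
      hasDerivAt_snd_deriv hD hZ ht u
    have d3 : HasDerivAt (fun v => Z v t) (deriv (fun v => Z v t) u) u := hasDerivAt_fst hZ ht u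
    have d4 : HasDerivAt Y (deriv Y u) u := (hY.differentiable (by simp)).differentiableAt.hasDerivAt
    have re {f : ℝ → ℂ} {f' : ℂ} {x : ℝ} (h : HasDerivAt f f' x) :
        HasDerivAt (fun y => (f y).re) f'.re x := Complex.reCLM.hasFDerivAt.comp_hasDerivAt x h
    have im {f : ℝ → ℂ} {f' : ℂ} {x : ℝ} (h : HasDerivAt f f' x) :
        HasDerivAt (fun y => (f y).im) f'.im x := Complex.imCLM.hasFDerivAt.comp_hasDerivAt x h
    have e1 := (((re d1).mul (im d2)).sub ((im d1).mul (re d2))).deriv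
    have e2 := (((re d3).mul (im d4)).sub ((im d3).mul (re d4))).deriv
    have hg := (speed_pos (hreg t ht u)).ne'
    have e3 : inner ℝ (Y u) (unitNormal (fun u => Z u t) u) * speed (fun u => Z u t) u =
        (Y u).im * (deriv (fun v => Z v t) u).re - (Y u).re * (deriv (fun v => Z v t) u).im := by
      rw [unitNormal, deriv_eq_speed_mul (hreg t ht u)]
      simp [Complex.inner]
      ring
    refine e1.trans ?_
    rw [e3]
    refine Eq.trans ?_ (congrArg (· + _) e2.symm)
    ring

/-- Here `a, b, c` stand for `p, p', p''` at `θ`, `τ` for `T`, `y` for the velocity `Y`, `w` for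
`Y_u / γ_u` and `k` for `κ g`. With `Q = pT + p'N` one has `∂_t (p g) = ⟨Y_u, Q⟩` and `∂_u Q = φ κ g
N`; the identity is the product rule for `⟨Y, Q⟩`. -/
theorem length_variation_identity (y w : ℂ) {τ : ℂ} (hτ : τ.re * τ.re + τ.im * τ.im = 1 ^ 2)
    (a b c k g : ℝ) :
    b * w.im * g + a * (g * w.re) =
      inner ℝ y ((((b * k : ℝ) : ℂ) + ((c * k : ℝ) : ℂ) * Complex.I) * τ +
        ((a : ℂ) + (b : ℂ) * Complex.I) * (Complex.I * τ * (k : ℂ))) +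
      inner ℝ (w * ((g : ℂ) * τ)) (((a : ℂ) + (b : ℂ) * Complex.I) * τ) +
      -(inner ℝ y (Complex.I * τ) * ((c + a) * k)) := by
  simp only [Complex.inner, Complex.mul_re, Complex.mul_im, Complex.conj_re, Complex.conj_im,
    Complex.I_re, Complex.I_im, Complex.ofReal_re, Complex.ofReal_im, Complex.add_re,
    Complex.add_im]
  linear_combination (-(b * w.im * g + a * (g * w.re))) * hτ

/-- First variation of the anisotropic length. -/
theorem hasDerivAt_anisoLength (hD : IsOpen D)
    (hZ : ContDiffOn ℝ ∞ (fun z : ℝ × ℝ => Z z.1 z.2) (univ ×ˢ D))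
    (hper : ∀ t ∈ D, Function.Periodic (fun u => Z u t) (2 * π))
    (hreg : ∀ t ∈ D, ∀ u, deriv (fun v => Z v t) u ≠ 0) {t : ℝ} (ht : t ∈ D) (hp : IsAdmissible p) :
    HasDerivAt (fun τ => anisoLength p fun u => Z u τ)
      (-arcIntegral (fun u => Z u t) fun u =>
        inner ℝ (deriv (fun τ => Z u τ) t) (unitNormal (fun u => Z u t) u) *
          anisoCurvature p (fun u => Z u t) u) t := by
  have hG := contDiffOn_length_integrand hD.uniqueDiffOn hZ hreg hp.periodic hp.smooth
  have hY := contDiff_deriv_snd_slice hD hZ ht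
  have hGt := (contDiff_deriv_snd_slice (Z := fun u τ => p (tangentAngle (fun v => Z v τ) u) *
    speed (fun v => Z v τ) u) hD hG ht).continuous
  have hz := contDiff_slice (contDiffOn_deriv_fst hD.uniqueDiffOn hZ
    (Z := Z)) ht (Z := fun u t => deriv (fun v => Z v t) u)
  have hang {F : ℝ → ℝ} (hF : Function.Periodic F (2 * π)) (hFs : ContDiff ℝ ∞ F) :
      ContDiff ℝ ∞ fun u => F (tangentAngle (fun v => Z v t) u) :=
    contDiff_slice (Z := fun u t => F (tangentAngle (fun v => Z v t) u))
      (contDiffOn_comp_tangentAngle hD.uniqueDiffOn hZ hreg hF hFs) ht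
  refine (hasDerivAt_parametric_integral hD hG 0 (2 * π) ht).congr_deriv ?_
  rw [arcIntegral, ← intervalIntegral.integral_neg]
  set Y : ℝ → ℂ := fun u => deriv (fun τ => Z u τ) t
  set γ : ℝ → ℂ := fun u => Z u t
  have hp' := periodic_deriv hp.periodic
  have hreg' : ∀ u, deriv γ u ≠ 0 := hreg t ht
  refine integral_eq_of_eq_deriv_add
    (f := fun u => inner ℝ (Y u) (((p (tangentAngle γ u) : ℂ) +
      ((deriv p (tangentAngle γ u) : ℝ) : ℂ) * Complex.I) * unitTangent γ u)) ?_ (fun u => ?_)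
    hGt fun u => ?_
  · refine hY.inner ℝ (((Complex.ofRealCLM.contDiff.comp (hang hp.periodic hp.smooth)).add
      ((Complex.ofRealCLM.contDiff.comp (hang hp' hp.contDiff_deriv)).mul contDiff_const)).mul ?_)
    exact contDiff_div hz (Complex.ofRealCLM.contDiff.comp (hz.norm ℝ hreg'))
      fun u => Complex.ofReal_ne_zero.2 (norm_ne_zero_iff.2 (hreg' u))
  · have h1 : deriv γ (u + 2 * π) = deriv γ u := periodic_deriv (hper t ht) u
    have h2 : Y (u + 2 * π) = Y u := periodic_deriv_snd hD hper ht u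
    simp only [tangentAngle, unitTangent, speed, h1, h2]
  · have d2 : HasDerivAt (fun τ => deriv (fun v => Z v τ) u) (deriv Y u) t :=
      hasDerivAt_snd_deriv hD hZ ht u
    have d3 : HasDerivAt (deriv γ) (deriv (deriv γ) u) u :=
      (hz.differentiable (by simp)).differentiableAt.hasDerivAt
    have d4 : HasDerivAt Y (deriv Y u) u := (hY.differentiable (by simp)).differentiableAt.hasDerivAt
    have dp0 : HasDerivAt p (deriv p (tangentAngle γ u)) (tangentAngle γ u) :=
      (hp.smooth.differentiable (by simp)).differentiableAt.hasDerivAt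
    have dp1 : HasDerivAt (deriv p) (deriv (deriv p) (tangentAngle γ u)) (tangentAngle γ u) :=
      (hp.contDiff_deriv.differentiable (by simp)).differentiableAt.hasDerivAt
    have e1 := ((hasDerivAt_comp_arg hp.periodic d2 (hreg' u) dp0).mul
      (hasDerivAt_norm d2 (hreg' u))).deriv
    have hQ := ((hasDerivAt_comp_arg hp.periodic d3 (hreg' u) dp0).ofReal_comp.add
      ((hasDerivAt_comp_arg hp' d3 (hreg' u) dp1).ofReal_comp.mul_const Complex.I)).mul
      (hasDerivAt_div_norm d3 (hreg' u))
    have e2 := (d4.inner ℝ hQ).deriv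
    have e3 := curvature_mul_speed (hreg' u)
    have hT := norm_unitTangent (hreg' u)
    rw [← sq_eq_sq₀ (norm_nonneg _) zero_le_one, ← Complex.normSq_eq_norm_sq,
      Complex.normSq_apply] at hT
    refine e1.trans (Eq.trans ?_ (congrArg (· + _) e2.symm))
    have hw : deriv Y u = deriv Y u / deriv γ u * (speed γ u * unitTangent γ u) := by
      rw [← deriv_eq_speed_mul (hreg' u), div_mul_cancel₀ _ (hreg' u)]
    have key := length_variation_identity (Y u) (deriv Y u / deriv γ u) hT
      (p (tangentAngle γ u)) (deriv p (tangentAngle γ u)) (deriv (deriv p) (tangentAngle γ u))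
      (deriv (deriv γ) u / deriv γ u).im (speed γ u)
    rw [← hw] at key
    refine key.trans (congrArg _ ?_)
    rw [unitNormal, anisoCurvature, anisotropy, ← e3]
    ring

/-- The integral of a function of the tangent angle against `κ ds` is stationary. -/
theorem hasDerivAt_integral_comp_tangentAngle_mul_curvature (hD : IsOpen D)
    (hZ : ContDiffOn ℝ ∞ (fun z : ℝ × ℝ => Z z.1 z.2) (univ ×ˢ D))
    (hper : ∀ t ∈ D, Function.Periodic (fun u => Z u t) (2 * π))
    (hreg : ∀ t ∈ D, ∀ u, deriv (fun v => Z v t) u ≠ 0) {t : ℝ} (ht : t ∈ D)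
    (hF : Function.Periodic F (2 * π)) (hFs : ContDiff ℝ ∞ F) :
    HasDerivAt (fun τ => ∫ u in (0 : ℝ)..(2 * π), F (tangentAngle (fun v => Z v τ) u) *
      (deriv (deriv fun v => Z v τ) u / deriv (fun v => Z v τ) u).im) 0 t := by
  have hG := contDiffOn_turning_integrand hD.uniqueDiffOn hZ hreg hF hFs
  have hY := contDiff_deriv_snd_slice hD hZ ht
  have hGt := (contDiff_deriv_snd_slice (Z := fun u τ => F (tangentAngle (fun v => Z v τ) u) *
    (deriv (deriv fun v => Z v τ) u / deriv (fun v => Z v τ) u).im) hD hG ht).continuous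
  have hz := contDiff_slice (contDiffOn_deriv_fst hD.uniqueDiffOn hZ
    (Z := Z)) ht (Z := fun u t => deriv (fun v => Z v t) u)
  have hang : ContDiff ℝ ∞ fun u => F (tangentAngle (fun v => Z v t) u) :=
    contDiff_slice (Z := fun u t => F (tangentAngle (fun v => Z v t) u))
      (contDiffOn_comp_tangentAngle hD.uniqueDiffOn hZ hreg hF hFs) ht
  refine (hasDerivAt_parametric_integral hD hG 0 (2 * π) ht).congr_deriv ?_
  refine Eq.trans ?_ (intervalIntegral.integral_zero (a := 0) (b := 2 * π)
    (μ := MeasureTheory.volume))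
  set Y : ℝ → ℂ := fun u => deriv (fun τ => Z u τ) t
  set γ : ℝ → ℂ := fun u => Z u t
  have hreg' : ∀ u, deriv γ u ≠ 0 := hreg t ht
  have hY' := (contDiff_infty_iff_deriv.1 hY).2
  -- The exact term is `∂_u (F(θ) θ_t)`: both it and `∂_t (F(θ) θ_u)` equal `F' θ_t θ_u + F θ_{tu}`.
  refine integral_eq_of_eq_deriv_add
    (f := fun u => F (tangentAngle γ u) * (deriv Y u / deriv γ u).im) ?_ (fun u => ?_)
    hGt fun u => ?_
  · exact hang.mul (Complex.imCLM.contDiff.comp (contDiff_div hY' hz hreg'))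
  · have h1 : deriv γ (u + 2 * π) = deriv γ u := periodic_deriv (hper t ht) u
    have h2 : deriv Y (u + 2 * π) = deriv Y u :=
      periodic_deriv (periodic_deriv_snd hD hper ht) u
    simp only [tangentAngle, h1, h2]
  · have im {f : ℝ → ℂ} {f' : ℂ} {x : ℝ} (h : HasDerivAt f f' x) :
        HasDerivAt (fun y => (f y).im) f'.im x := Complex.imCLM.hasFDerivAt.comp_hasDerivAt x h
    have d1 : HasDerivAt (fun τ => deriv (fun v => Z v τ) u) (deriv Y u) t :=
      hasDerivAt_snd_deriv hD hZ ht u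
    have d2 : HasDerivAt (fun τ => deriv (deriv fun v => Z v τ) u) (deriv (deriv Y) u) t :=
      hasDerivAt_snd_deriv_deriv hD hZ ht u
    have d3 : HasDerivAt (deriv γ) (deriv (deriv γ) u) u :=
      (hz.differentiable (by simp)).differentiableAt.hasDerivAt
    have d4 : HasDerivAt (deriv Y) (deriv (deriv Y) u) u :=
      (hY'.differentiable (by simp)).differentiableAt.hasDerivAt
    have dF : HasDerivAt F (deriv F (tangentAngle γ u)) (tangentAngle γ u) :=
      (hFs.differentiable (by simp)).differentiableAt.hasDerivAt
    have e1 := ((hasDerivAt_comp_arg hF d1 (hreg' u) dF).mul (im (d2.div d1 (hreg' u)))).deriv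
    have e2 := ((hasDerivAt_comp_arg hF d3 (hreg' u) dF).mul (im (d4.div d3 (hreg' u)))).deriv
    refine e1.trans (Eq.trans ?_ (congrArg (· + _) e2.symm))
    rw [add_zero]
    change _ * (deriv Y u / deriv γ u).im * (deriv (deriv γ) u / deriv γ u).im +
      F (tangentAngle γ u) *
        ((deriv (deriv Y) u * deriv γ u - deriv (deriv γ) u * deriv Y u) / deriv γ u ^ 2).im =
      _ * (deriv (deriv γ) u / deriv γ u).im * (deriv Y u / deriv γ u).im +
      F (tangentAngle γ u) *
        ((deriv (deriv Y) u * deriv γ u - deriv Y u * deriv (deriv γ) u) / deriv γ u ^ 2).im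
    rw [mul_comm (deriv (deriv γ) u) (deriv Y u), mul_right_comm]

end Variation

/-! ### The time interval, with derivatives only in its interior -/

section TimeInterval

variable {T : EReal}

theorem convex_timeInterval (T : EReal) : Convex ℝ (timeInterval T) :=
  OrdConnected.convex ⟨fun _ hx _ hy _ hz =>
    ⟨hx.1.trans hz.1, lt_of_le_of_lt (EReal.coe_le_coe_iff.2 hz.2) hy.2⟩⟩

theorem zero_mem_timeInterval (hT : 0 < T) : (0 : ℝ) ∈ timeInterval T := ⟨le_rfl, hT⟩

theorem uniqueDiffOn_timeInterval (hT : 0 < T) : UniqueDiffOn ℝ (timeInterval T) := by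
  obtain ⟨a, ha0, haT⟩ := EReal.lt_iff_exists_real_btwn.1 hT
  refine uniqueDiffOn_convex (convex_timeInterval T) ⟨a / 2, mem_interior.2
    ⟨Ioo 0 a, fun t ht => ⟨ht.1.le, lt_trans (EReal.coe_lt_coe_iff.2 ht.2) haT⟩, isOpen_Ioo, ?_⟩⟩
  have : 0 < a := EReal.coe_pos.1 ha0
  constructor <;> linarith

theorem eq_of_hasDerivAt_zero {f : ℝ → ℝ} {I : Set ℝ} (hI : Convex ℝ I) (hf : ContinuousOn f I)
    (h : ∀ t ∈ interior I, HasDerivAt f 0 t) {s t : ℝ} (hs : s ∈ I) (ht : t ∈ I) (hst : s ≤ t) :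
    f t = f s := by
  have hd : DifferentiableOn ℝ f (interior I) := fun t ht =>
    (h t ht).differentiableAt.differentiableWithinAt
  exact le_antisymm
    (antitoneOn_of_deriv_nonpos hI hf hd (fun t ht => (h t ht).deriv.le) hs ht hst)
    (monotoneOn_of_deriv_nonneg hI hf hd (fun t ht => (h t ht).deriv.ge) hs ht hst)

end TimeInterval

/-! ### Continuity along a curve and Cauchy–Schwarz -/

section Curve

variable {γ : ℝ → ℂ} {p : ℝ → ℝ}

theorem arcIntegral_add_const_mul {f g : ℝ → ℝ} (c : ℝ) (hf : Continuous f) (hg : Continuous g)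
    (hs : Continuous (speed γ)) :
    arcIntegral γ (fun u => f u + c * g u) = arcIntegral γ f + c * arcIntegral γ g := by
  have h1 : Continuous fun u => f u * speed γ u := hf.mul hs
  have h2 : Continuous fun u => c * (g u * speed γ u) := continuous_const.mul (hg.mul hs)
  simp only [arcIntegral]
  rw [← intervalIntegral.integral_const_mul, ← intervalIntegral.integral_add
    (h1.intervalIntegrable _ _) (h2.intervalIntegrable _ _)]
  exact intervalIntegral.integral_congr fun u _ => by ring

theorem contDiff_infty_deriv (hγ : ContDiff ℝ ∞ γ) : ContDiff ℝ ∞ (deriv γ) :=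
  (contDiff_infty_iff_deriv.1 hγ).2

theorem continuous_speed (hγ : ContDiff ℝ ∞ γ) : Continuous (speed γ) :=
  (contDiff_infty_deriv hγ).continuous.norm

theorem continuous_comp_tangentAngle (hγ : ContDiff ℝ ∞ γ) (hreg : ∀ u, deriv γ u ≠ 0) {F : ℝ → ℝ}
    (hF : Function.Periodic F (2 * π)) (hFs : ContDiff ℝ ∞ F) :
    Continuous fun u => F (tangentAngle γ u) :=
  continuous_iff_continuousAt.2 fun u => ContinuousAt.comp (g := fun w => F (Complex.arg w))
    (contDiffAt_comp_arg hF hFs (hreg u)).continuousAt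
    (contDiff_infty_deriv hγ).continuous.continuousAt

theorem continuous_curvature (hγ : ContDiff ℝ ∞ γ) (hreg : ∀ u, deriv γ u ≠ 0) :
    Continuous (curvature γ) := by
  have h1 := (contDiff_infty_deriv hγ).continuous
  have h2 := (contDiff_infty_deriv (contDiff_infty_deriv hγ)).continuous
  exact (((Complex.continuous_re.comp h1).mul (Complex.continuous_im.comp h2)).sub
    ((Complex.continuous_im.comp h1).mul (Complex.continuous_re.comp h2))).div
    ((continuous_speed hγ).pow 3) fun u => pow_ne_zero 3 (speed_pos (hreg u)).ne'

theorem continuous_anisoCurvature (hp : IsAdmissible p) (hγ : ContDiff ℝ ∞ γ)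
    (hreg : ∀ u, deriv γ u ≠ 0) : Continuous (anisoCurvature p γ) :=
  (continuous_comp_tangentAngle hγ hreg hp.periodic_anisotropy hp.contDiff_anisotropy).mul
    (continuous_curvature hγ hreg)

theorem anisoLength_pos (hp : IsAdmissible p) (hγ : ContDiff ℝ ∞ γ) (hreg : ∀ u, deriv γ u ≠ 0) :
    0 < anisoLength p γ :=
  intervalIntegral.intervalIntegral_pos_of_pos
    (((continuous_comp_tangentAngle hγ hreg hp.periodic hp.smooth).mul
      (continuous_speed hγ)).intervalIntegrable _ _)
    (fun u => mul_pos (hp.pos _) (speed_pos (hreg u))) (by positivity)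

/-- The Cauchy–Schwarz inequality for the measure `p(θ) ds`. -/
theorem sq_arcIntegral_anisoCurvature_le (hp : IsAdmissible p) (hγ : ContDiff ℝ ∞ γ)
    (hreg : ∀ u, deriv γ u ≠ 0) :
    arcIntegral γ (fun u => p (tangentAngle γ u) * anisoCurvature p γ u) ^ 2 ≤
      lam p γ * anisoLength p γ := by
  have hP := continuous_comp_tangentAngle hγ hreg hp.periodic hp.smooth
  have hK := continuous_anisoCurvature hp hγ hreg
  have hPK : Continuous fun u => p (tangentAngle γ u) * anisoCurvature p γ u := hP.mul hK
  have hPK2 : Continuous fun u => p (tangentAngle γ u) * anisoCurvature p γ u ^ 2 :=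
    hP.mul (hK.pow 2)
  have hs := continuous_speed hγ
  have hL := anisoLength_pos hp hγ hreg
  set m := arcIntegral γ (fun u => p (tangentAngle γ u) * anisoCurvature p γ u)
  -- `c` is the mean of `𝒦` for `p ds`, the choice that minimizes `∫ p (𝒦 - c)² ds`; nonnegativity
  -- of this integral reads `λ - m²/ℒ ≥ 0`.
  set c := m / anisoLength p γ
  have h0 : 0 ≤ arcIntegral γ fun u => (p (tangentAngle γ u) * anisoCurvature p γ u ^ 2 +
      (-2 * c) * (p (tangentAngle γ u) * anisoCurvature p γ u)) + c ^ 2 * p (tangentAngle γ u) := by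
    refine intervalIntegral.integral_nonneg (by positivity) fun u _ => ?_
    refine mul_nonneg ?_ (norm_nonneg _)
    have := mul_nonneg (hp.pos (tangentAngle γ u)).le (sq_nonneg (anisoCurvature p γ u - c))
    linarith
  rw [arcIntegral_add_const_mul (f := fun u => p (tangentAngle γ u) * anisoCurvature p γ u ^ 2 +
      (-2 * c) * (p (tangentAngle γ u) * anisoCurvature p γ u)) _ (hPK2.add (continuous_const.mul hPK)) hP hs,
    arcIntegral_add_const_mul _ hPK2 hPK hs] at h0
  change 0 ≤ lam p γ + -2 * c * m + c ^ 2 * anisoLength p γ at h0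
  have hcm : c * anisoLength p γ = m := div_mul_cancel₀ _ hL.ne'
  nlinarith [mul_nonneg h0 hL.le]

end Curve

/-! ### The variation formulas along the flow -/

section Flow

variable {p : ℝ → ℝ} {X₀ : ℝ → ℂ} {T : EReal} {ξ : ℝ → ℝ → ℝ} {X : ℝ → ℝ → ℂ}

theorem inner_unitNormal {γ : ℝ → ℂ} {u : ℝ} (h : deriv γ u ≠ 0) (a b : ℝ) :
    inner ℝ ((a : ℂ) * unitTangent γ u + (b : ℂ) * unitNormal γ u) (unitNormal γ u) = b := by
  have hT := norm_unitTangent h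
  rw [← sq_eq_sq₀ (norm_nonneg _) zero_le_one, ← Complex.normSq_eq_norm_sq,
    Complex.normSq_apply] at hT
  simp only [unitNormal, Complex.inner, Complex.mul_re, Complex.mul_im, Complex.conj_re,
    Complex.conj_im, Complex.I_re, Complex.I_im, Complex.ofReal_re, Complex.ofReal_im,
    Complex.add_re, Complex.add_im]
  linear_combination b * hT

theorem IsFlow.contDiff (hX : IsFlow p X₀ T ξ X) {t : ℝ} (ht : t ∈ timeInterval T) :
    ContDiff ℝ ∞ fun u => X u t := contDiff_slice hX.smooth ht

theorem IsFlow.contDiffOn_interior (hX : IsFlow p X₀ T ξ X) :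
    ContDiffOn ℝ ∞ (fun z : ℝ × ℝ => X z.1 z.2) (univ ×ˢ interior (timeInterval T)) :=
  hX.smooth.mono (prod_mono Subset.rfl interior_subset)

theorem IsFlow.inner_deriv_unitNormal (hX : IsFlow p X₀ T ξ X) {t : ℝ}
    (ht : t ∈ interior (timeInterval T)) (u : ℝ) :
    inner ℝ (deriv (fun τ => X u τ) t) (unitNormal (fun v => X v t) u) =
      normalSpeed p (fun v => X v t) u := by
  have ht' := interior_subset ht
  rw [((hX.evolution t ht' u).hasDerivAt (mem_interior_iff_mem_nhds.1 ht)).deriv]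
  exact inner_unitNormal (hX.regular t ht' u) _ _

/-- Along the flow `∫ p(θ) 𝒦 ds` keeps the value `2 Ã`. -/
theorem IsFlow.arcIntegral_anisoCurvature (hp : IsAdmissible p) (hX₀ : IsConvexCurve X₀)
    (hT : 0 < T) (hX : IsFlow p X₀ T ξ X) {t : ℝ} (ht : t ∈ timeInterval T) :
    arcIntegral (fun u => X u t) (fun u => p (tangentAngle (fun u => X u t) u) *
      anisoCurvature p (fun u => X u t) u) = 2 * wulffArea p := by
  set F : ℝ → ℝ := fun θ => p θ * anisotropy p θ with hFdef
  have hF : Function.Periodic F (2 * π) := hp.periodic.mul hp.periodic_anisotropy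
  have hFs : ContDiff ℝ ∞ F := hp.smooth.mul hp.contDiff_anisotropy
  set M : ℝ → ℝ := fun τ => ∫ u in (0 : ℝ)..(2 * π), F (tangentAngle (fun v => X v τ) u) *
    (deriv (deriv fun v => X v τ) u / deriv (fun v => X v τ) u).im
  have hMt : ∀ τ ∈ timeInterval T, arcIntegral (fun u => X u τ)
      (fun u => F (tangentAngle (fun u => X u τ) u) * curvature (fun u => X u τ) u) = M τ :=
    fun τ hτ => arcIntegral_mul_curvature (hX.regular τ hτ) _
  have h0 := zero_mem_timeInterval hT
  have hc : M t = M 0 := eq_of_hasDerivAt_zero (convex_timeInterval T)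
    (continuousOn_parametric_integral (contDiffOn_turning_integrand (uniqueDiffOn_timeInterval hT)
      hX.smooth hX.regular hF hFs) 0 (2 * π))
    (fun τ hτ => hasDerivAt_integral_comp_tangentAngle_mul_curvature isOpen_interior
      hX.contDiffOn_interior (fun s hs => hX.closed s (interior_subset hs))
      (fun s hs => hX.regular s (interior_subset hs)) hτ hF hFs) h0 ht ht.1
  -- Convexity enters only at time `0`; constancy of `M` carries the value to time `t`.
  rw [hp.two_mul_wulffArea, ← hX₀.arcIntegral_comp_tangentAngle_mul_curvature hF hFs.continuous,
    show X₀ = fun u => X u 0 from funext fun u => (hX.initial u).symm, hMt 0 h0, ← hc, ← hMt t ht]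
  simp only [hFdef, anisoCurvature, mul_assoc]

/-- The factor `λ/(2Ã)` is tuned for this: `∫ V 𝒦 ds = λ - (λ/(2Ã)) ∫ p 𝒦 ds`, and the last integral
is `2Ã`. -/
theorem IsFlow.hasDerivAt_anisoLength (hp : IsAdmissible p) (hX₀ : IsConvexCurve X₀)
    (hT : 0 < T) (hX : IsFlow p X₀ T ξ X) {t : ℝ} (ht : t ∈ interior (timeInterval T)) :
    HasDerivAt (fun τ => anisoLength p fun u => X u τ) 0 t := by
  have ht' := interior_subset ht
  refine (AnisotropicFlow.hasDerivAt_anisoLength isOpen_interior hX.contDiffOn_interior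
    (fun s hs => hX.closed s (interior_subset hs))
    (fun s hs => hX.regular s (interior_subset hs)) ht hp).congr_deriv ?_
  simp only [hX.inner_deriv_unitNormal ht]
  have hm := hX.arcIntegral_anisoCurvature hp hX₀ hT ht'
  have hP := continuous_comp_tangentAngle (hX.contDiff ht') (hX.regular t ht') hp.periodic hp.smooth
  have hK := continuous_anisoCurvature hp (hX.contDiff ht') (hX.regular t ht')
  have hPK : Continuous fun u => p (tangentAngle (fun u => X u t) u) *
      anisoCurvature p (fun u => X u t) u := hP.mul hK
  have hPK2 : Continuous fun u => p (tangentAngle (fun u => X u t) u) *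
      anisoCurvature p (fun u => X u t) u ^ 2 := hP.mul (hK.pow 2)
  have h := arcIntegral_add_const_mul (-(lam p (fun u => X u t) / (2 * wulffArea p)))
    hPK2 hPK (continuous_speed (hX.contDiff ht'))
  rw [hm, ← lam, neg_mul, div_mul_cancel₀ _ (mul_pos two_pos hp.wulffArea_pos).ne',
    add_neg_cancel] at h
  rw [neg_eq_zero, ← h]
  congr 1
  funext u
  rw [normalSpeed]
  ring

/-- Here `∫ V ds = ∫ p 𝒦 ds - (λ/(2Ã)) ℒ = 2Ã - λℒ/(2Ã)`, and the area changes at the opposite rate.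
-/
theorem IsFlow.hasDerivAt_enclosedArea (hp : IsAdmissible p) (hX₀ : IsConvexCurve X₀)
    (hT : 0 < T) (hX : IsFlow p X₀ T ξ X) {t : ℝ} (ht : t ∈ interior (timeInterval T)) :
    HasDerivAt (fun τ => enclosedArea fun u => X u τ)
      ((lam p (fun u => X u t) * anisoLength p (fun u => X u t) - (2 * wulffArea p) ^ 2) /
        (2 * wulffArea p)) t := by
  have ht' := interior_subset ht
  refine (AnisotropicFlow.hasDerivAt_enclosedArea isOpen_interior hX.contDiffOn_interior
    (fun s hs => hX.closed s (interior_subset hs))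
    (fun s hs => hX.regular s (interior_subset hs)) ht).congr_deriv ?_
  simp only [hX.inner_deriv_unitNormal ht]
  have hm := hX.arcIntegral_anisoCurvature hp hX₀ hT ht'
  have hP := continuous_comp_tangentAngle (hX.contDiff ht') (hX.regular t ht') hp.periodic hp.smooth
  have hK := continuous_anisoCurvature hp (hX.contDiff ht') (hX.regular t ht')
  have hPK : Continuous fun u => p (tangentAngle (fun u => X u t) u) *
      anisoCurvature p (fun u => X u t) u := hP.mul hK
  have h := arcIntegral_add_const_mul (-(lam p (fun u => X u t) / (2 * wulffArea p)))
    hPK hP (continuous_speed (hX.contDiff ht'))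
  rw [hm, ← anisoLength] at h
  have hV : normalSpeed p (fun u => X u t) = fun u => p (tangentAngle (fun u => X u t) u) *
      anisoCurvature p (fun u => X u t) u +
        -(lam p (fun u => X u t) / (2 * wulffArea p)) * p (tangentAngle (fun u => X u t) u) := by
    funext u
    rw [normalSpeed]
    ring
  have hA := hp.wulffArea_pos.ne'
  refine (congrArg (fun f => -arcIntegral (fun u => X u t) f) hV).trans ?_
  rw [h]
  field_simp
  ring

end Flow

end AnisotropicFlow

/-! ### Conclusion -/

theorem mainTheorem3 (p : ℝ → ℝ) (hp : AnisotropicFlow.IsAdmissible p)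
    (X₀ : ℝ → ℂ) (hX₀ : AnisotropicFlow.IsConvexCurve X₀)
    (T : EReal) (hT : 0 < T) (ξ : ℝ → ℝ → ℝ) (X : ℝ → ℝ → ℂ)
    (hX : AnisotropicFlow.IsFlow p X₀ T ξ X) :
    (∀ t ∈ AnisotropicFlow.timeInterval T,
      AnisotropicFlow.anisoLength p (fun u => X u t) = AnisotropicFlow.anisoLength p X₀) ∧
    MonotoneOn (fun t => AnisotropicFlow.enclosedArea (fun u => X u t))
      (AnisotropicFlow.timeInterval T) := by
  open AnisotropicFlow in
  have hI := convex_timeInterval T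
  have hu := uniqueDiffOn_timeInterval hT
  constructor
  · intro t ht
    have hc := continuousOn_parametric_integral (G := fun u t =>
      p (tangentAngle (fun v => X v t) u) * speed (fun v => X v t) u)
      (contDiffOn_length_integrand hu hX.smooth hX.regular hp.periodic hp.smooth) 0 (2 * π)
    have h := eq_of_hasDerivAt_zero (f := fun t => anisoLength p fun u => X u t) hI hc
      (fun s hs => hX.hasDerivAt_anisoLength hp hX₀ hT hs) (zero_mem_timeInterval hT) ht ht.1
    rwa [show X₀ = fun u => X u 0 from funext fun u => (hX.initial u).symm]
  · have hc := continuousOn_parametric_integral (G := fun u t =>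
      (X u t).re * (deriv (fun v => X v t) u).im - (X u t).im * (deriv (fun v => X v t) u).re)
      (contDiffOn_area_integrand hu hX.smooth) 0 (2 * π)
    have hd := fun s hs => hX.hasDerivAt_enclosedArea hp hX₀ hT (t := s) hs
    refine monotoneOn_of_deriv_nonneg hI (continuousOn_const.mul hc)
      (fun s hs => (hd s hs).differentiableAt.differentiableWithinAt) fun s hs => ?_
    rw [(hd s hs).deriv]
    have hs' := interior_subset hs
    -- Cauchy–Schwarz with `∫ p 𝒦 ds = 2Ã` says that the numerator of `dA/dt` is nonnegative.
    have := sq_arcIntegral_anisoCurvature_le hp (hX.contDiff hs') (hX.regular s hs')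
    rw [hX.arcIntegral_anisoCurvature hp hX₀ hT hs'] at this
    exact div_nonneg (sub_nonneg.2 this) (mul_pos two_pos hp.wulffArea_pos).le
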